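/- Fix an optimal programming language $U$, that is, a partial computable function $U:\{0,1\}^*\times\{0,1\}^*\to\{0,1\}^*$ (program, input $\mapsto$ output) such that for every partial computable $F:\{0,1\}^*\times\{0,1\}^*\to\{0,1\}^*$ there is a string $t_F$ with $U(t_Fp,x)=F(p,x)$ for all strings $p,x$. Let $C(x|y)=\min\{|p| : U(p,y)=x\}$ and $C(x)=C(x|\Lambda)$, where $\Lambda$ is the empty string. Encode a pair $(u,v)$ of strings by $[u,v]=0^{|u|}1uv$, and write $C(u,v)=C([u,v])$, $C(u,v|x)=C([u,v]|x)$, $C(y|u,v)=C(y|[u,v])$. Theorem. There is a constant $c$, depending only on $U$, such that for every natural number $\varepsilon$ there are strings $x,y,z$, each of length less than $9\varepsilon+c$, with the following property: for all strings $p,q$ with $$C(y|p,x)<\varepsilon,\qquad C(z|q,x)<\varepsilon,\qquad C(p)<C(y|x)+\varepsilon-c,\qquad C(q)<C(z|x)+\varepsilon-c$$ we have $$C(p,q)-C(p,q|x)\ge\varepsilon-c.$$ -/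

import Mathlib

namespace Kolmogorov

/-- Finite binary strings. -/
abbrev Str : Type := List Bool

/-- The encoding `[x, y] = 0^{|x|} 1 x y` of the pair `(x, y)` by a single string. -/
def pair (x y : Str) : Str :=
  List.replicate x.length false ++ true :: (x ++ y)

/-- A programming language is a partial computable function of a program (first argument) and an
input (second argument). -/
def IsLanguage (F : Str → Str →. Str) : Prop :=
  Partrec₂ F

/-- A programming language `U` is optimal if for every programming language `F` there is a string
`t` such that `U (t p) x = F p x` for all `p`, `x` (both sides undefined, or both defined and
equal). -/
def IsOptimal (U : Str → Str →. Str) : Prop :=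
  IsLanguage U ∧
    ∀ F : Str → Str →. Str, IsLanguage F → ∃ t : Str, ∀ p x : Str, U (t ++ p) x = F p x

/-- Conditional Kolmogorov complexity `C(x|y)`: the least length of a program `p` with
`U p y = x`. -/
noncomputable def condC (U : Str → Str →. Str) (x y : Str) : ℕ :=
  sInf {n : ℕ | ∃ p : Str, p.length = n ∧ x ∈ U p y}

/-- Kolmogorov complexity `C(x) = C(x|Λ)`, where `Λ` is the empty string. -/
noncomputable def plainC (U : Str → Str →. Str) (x : Str) : ℕ :=
  condC U x []

/-- For an optimal language the minimum that defines `C(x|y)` is over a nonempty set, and so it is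
attained. -/
theorem IsOptimal.exists_shortest {U : Str → Str →. Str} (hU : IsOptimal U) (x y : Str) :
    ∃ p : Str, p.length = condC U x y ∧ x ∈ U p y := by
  have hF : IsLanguage (fun p _ => Part.some p) :=
    (Computable.fst (α := Str) (β := Str)).partrec
  obtain ⟨t, ht⟩ := hU.2 _ hF
  refine Nat.sInf_mem (s := {n : ℕ | ∃ p : Str, p.length = n ∧ x ∈ U p y})
    ⟨_, t ++ x, rfl, ?_⟩
  rw [ht]
  exact Part.mem_some x

end Kolmogorov

/-!
The strings `y` and `z` are the ends of an edge of a bipartite graph `G_x` computed from `x`.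
Let `m` be the length of `y` and `z`. If `p` and `q` satisfy the hypotheses, then their complexities
are below `m + ε`, and they are *linked* to `y` and `z`: each program is linked, given `x`, to fewer
than `2 ^ ε` vertices, those that have complexity less than `ε` relative to the program and `x`.
Let `k` be the complexity of `[p, q]`. Given `x`, the pair `(p, q)` can be described by naming first
the edge `(y, z)` and then the pair `(p, q)` in an enumeration of all pairs of complexity at most
`k` that are linked to this edge. If the edge is not *heavy*, that is, if there are few such pairs for
every `k`, then this takes `k - ε + O(1)` bits, which is the claim
(`IsOptimal.exists_const_condC_pair_le`). No additive logarithms arise, because `ε` is determined by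
the length of `x`, and `k` by `ε` and the length of the description.

So a graph with a light edge is needed (`IsOptimal.exists_light_edge`). There are at most
`2 ^ (k + 1)` pairs of complexity at most `k`, each linked to at most `2 ^ (2 ε)` pairs of vertices; so the
heavy pairs of vertices are so few (`card_heavy_le`) that a random graph of suitable density contains only
a small fraction of them among its edges. Which pairs of vertices are heavy depends on two things:
the sets of pairs of bounded complexity, which are the same for all `x`, and the links, which depend
on `x`. For a single random graph the Chernoff bound `card_many_forbidden` survives the union over
all ways to link programs to vertices. It does not survive the union over all sets of pairs, but the
probability that *every* graph in a family of `2 ^ |x|` independent random graphs fails is small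
enough for that (`exists_family`). Hence there is a family such that, for arbitrary sets of pairs,
some graph of the family has at most half of its edges heavy, whatever the links are
(`exists_goodFamily`). This property of families is primitive recursive
(`primrecPred_goodFamily`), so that such a family is found by search, and `G_x` is computable from
`x`. The complexity of programs and their links enter only through this worst case over finite
objects, so that it does not matter that they are not computable.
-/

namespace Kolmogorov

/-! ### Primitive recursion with bounded quantifiers and counting -/

section Primrec

variable {α : Type*} [Primcodable α]

attribute [fun_prop] Primrec
attribute [fun_prop] Primrec.comp Primrec.id Primrec.const Primrec.pair Primrec.fst Primrec.snd

@[fun_prop]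
theorem primrec_add {f g : α → ℕ} (hf : Primrec f) (hg : Primrec g) :
    Primrec fun a => f a + g a :=
  Primrec.nat_add.comp hf hg

@[fun_prop]
theorem primrec_sub {f g : α → ℕ} (hf : Primrec f) (hg : Primrec g) :
    Primrec fun a => f a - g a :=
  Primrec.nat_sub.comp hf hg

@[fun_prop]
theorem primrec_mul {f g : α → ℕ} (hf : Primrec f) (hg : Primrec g) :
    Primrec fun a => f a * g a :=
  Primrec.nat_mul.comp hf hg

@[fun_prop]
theorem primrec_div {f g : α → ℕ} (hf : Primrec f) (hg : Primrec g) :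
    Primrec fun a => f a / g a :=
  Primrec.nat_div.comp hf hg

@[fun_prop]
theorem primrec_mod {f g : α → ℕ} (hf : Primrec f) (hg : Primrec g) :
    Primrec fun a => f a % g a :=
  Primrec.nat_mod.comp hf hg

@[fun_prop]
theorem primrec_pow {f g : α → ℕ} (hf : Primrec f) (hg : Primrec g) :
    Primrec fun a => f a ^ g a :=
  (Primrec₂.unpaired'.1 Nat.Primrec.pow).comp hf hg

theorem primrecPred_le {f g : α → ℕ} (hf : Primrec f) (hg : Primrec g) :
    PrimrecPred fun a => f a ≤ g a :=
  Primrec.nat_le.comp hf hg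

theorem primrecPred_lt {f g : α → ℕ} (hf : Primrec f) (hg : Primrec g) :
    PrimrecPred fun a => f a < g a :=
  Primrec.nat_lt.comp hf hg

theorem primrecPred_eq {f g : α → ℕ} (hf : Primrec f) (hg : Primrec g) :
    PrimrecPred fun a => f a = g a :=
  Primrec.eq.comp hf hg

theorem primrecPred_exists_lt {P : α → ℕ → Prop} {b : α → ℕ}
    (hP : PrimrecPred fun q : α × ℕ => P q.1 q.2) (hb : Primrec b) :
    PrimrecPred fun a => ∃ i < b a, P a i := by
  have h : PrimrecRel fun (i : ℕ) (a : α) => P a i :=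
    hP.comp (f := fun q : ℕ × α => (q.2, q.1)) (by fun_prop)
  exact (h.exists_mem_list.comp (Primrec.list_range.comp hb) Primrec.id).of_eq
    fun a => by simp

theorem primrecPred_forall_lt {P : α → ℕ → Prop} {b : α → ℕ}
    (hP : PrimrecPred fun q : α × ℕ => P q.1 q.2) (hb : Primrec b) :
    PrimrecPred fun a => ∀ i < b a, P a i := by
  have h : PrimrecRel fun (i : ℕ) (a : α) => P a i :=
    hP.comp (f := fun q : ℕ × α => (q.2, q.1)) (by fun_prop)
  exact (h.forall_mem_list.comp (Primrec.list_range.comp hb) Primrec.id).of_eq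
    fun a => by simp

theorem primrec_count {P : α → ℕ → Prop} [∀ a, DecidablePred (P a)] {b : α → ℕ}
    (hP : PrimrecPred fun q : α × ℕ => P q.1 q.2) (hb : Primrec b) :
    Primrec fun a => Nat.count (P a) (b a) := by
  classical
  have h : PrimrecRel fun (i : ℕ) (a : α) => P a i :=
    hP.comp (f := fun q : ℕ × α => (q.2, q.1)) (by fun_prop)
  refine (Primrec.list_length.comp
    (h.listFilter.comp (Primrec.list_range.comp hb) Primrec.id)).of_eq fun a => ?_
  simp only [id, ← List.countP_eq_length_filter]
  induction b a with
  | zero => simp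
  | succ n ih => simp [List.range_succ, List.countP_append, Nat.count_succ, ih,
      List.countP_singleton]

end Primrec

/-! ### Heavy edges and good families of graphs -/

/-- The `i`-th base-`b` digit of `v`. A number below `b ^ n` codes a function from `{0, …, n - 1}`
to `{0, …, b - 1}` through its digits, so that quantifiers over such functions become bounded
quantifiers over numbers. -/
def digit (b v i : ℕ) : ℕ := v / b ^ i % b

/-- The common length of the strings `y` and `z` found for the parameter `e`. -/
def vLen (e : ℕ) : ℕ := 7 * e + 26

/-- The binary logarithm of the degree of a left vertex in each of the graphs. -/
def dLen (e : ℕ) : ℕ := 3 * e + 10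

/-- The binary logarithm of the number of edges of each of the graphs. -/
def eLen (e : ℕ) : ℕ := vLen e + dLen e

/-- The length of the string `x`, which is also the binary logarithm of the number of graphs. -/
def xLen (e : ℕ) : ℕ := 8 * e + 26

/-- An upper bound for the number of strings `p` of complexity less than `vLen e + e`. -/
def numP (e : ℕ) : ℕ := 2 ^ (vLen e + e)

/-- The number of colours: the right vertices are split into `2 ^ dLen e` blocks of this size, and
every left vertex has one neighbour in each block. -/
def numD (e : ℕ) : ℕ := 2 ^ (vLen e - dLen e)

/-- From this complexity `k` of `[p, q]` on, there are so few pairs of programs that an edge and one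
of the pairs linked to it can always be named with `k - e` bits. -/
def kMax (e : ℕ) : ℕ := eLen e + e + 2 * (vLen e + e)

/-- The left end of the edge number `t`. -/
def leftEnd (e t : ℕ) : ℕ := t / 2 ^ dLen e

/-- The right end of the edge number `t`, if this edge has the colour `i`. -/
def rightEnd (e t i : ℕ) : ℕ := t % 2 ^ dLen e * numD e + i

/-- The colour of the edge number `t` in the graph number `x` of the family coded by `w`. -/
def colour (e w x t : ℕ) : ℕ := digit (numD e) w (x * 2 ^ eLen e + t)

/-- The program number `p` is linked to the vertex `y` by the code `f`, which assigns a list of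
`2 ^ e` vertices to every program number. -/
def Linked (e f p y : ℕ) : Prop := ∃ i < 2 ^ e, digit (2 ^ vLen e) f (p * 2 ^ e + i) = y

/-- The pair number `u` belongs to the `k`-th of the sets of pairs coded by `H`. The pair of the
programs number `p` and `q` has the number `numP e * p + q`. -/
def InLevel (e H k u : ℕ) : Prop := digit 2 H (k * (numP e * numP e) + u) = 1

/-- The pair number `u` belongs to the `k`-th set of pairs, and its components are linked to `y`
and to `z`. -/
def PairLinked (e H f k y z u : ℕ) : Prop :=
  InLevel e H k u ∧ Linked e f (u / numP e) y ∧ Linked e f (u % numP e) z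

open Classical in
/-- The number of pairs in the `k`-th set. -/
noncomputable def levelCard (e H k : ℕ) : ℕ :=
  Nat.count (InLevel e H k) (numP e * numP e)

open Classical in
/-- The number of pairs in the `k`-th set that are linked to `(y, z)`. -/
noncomputable def linkCount (e H f k y z : ℕ) : ℕ :=
  Nat.count (PairLinked e H f k y z) (numP e * numP e)

/-- The pair `(y, z)` is heavy if, for some level `k` of admissible size, so many pairs of programs
in the `k`-th set are linked to it that naming an edge and then one of its linked pairs takes at
least `k - e` bits. -/
def Heavy (e H f y z : ℕ) : Prop :=
  ∃ k < kMax e, levelCard e H k ≤ 2 ^ (k + 1) ∧ 0 < linkCount e H f k y z ∧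
    2 ^ k ≤ linkCount e H f k y z * 2 ^ (eLen e + e)

open Classical in
/-- The family of graphs coded by `w` is good if for all sets of pairs some graph of the family has
at most half of its edges heavy, no matter how programs are linked to vertices. -/
def GoodFamily (e w : ℕ) : Prop :=
  ∀ H < 2 ^ (kMax e * (numP e * numP e)), ∃ x < 2 ^ xLen e,
    ∀ f < (2 ^ vLen e) ^ (numP e * 2 ^ e),
      2 * Nat.count (fun t => Heavy e H f (leftEnd e t) (rightEnd e t (colour e w x t)))
        (2 ^ eLen e) ≤ 2 ^ eLen e

section Primrec

variable {α : Type*} [Primcodable α]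

@[fun_prop]
theorem primrec_digit {f g h : α → ℕ} (hf : Primrec f) (hg : Primrec g) (hh : Primrec h) :
    Primrec fun a => digit (f a) (g a) (h a) := by
  unfold digit; fun_prop

@[fun_prop]
theorem primrec_vLen : Primrec vLen := by unfold vLen; fun_prop

@[fun_prop]
theorem primrec_dLen : Primrec dLen := by unfold dLen; fun_prop

@[fun_prop]
theorem primrec_eLen : Primrec eLen := by unfold eLen; fun_prop

@[fun_prop]
theorem primrec_xLen : Primrec xLen := by unfold xLen; fun_prop

@[fun_prop]
theorem primrec_numP : Primrec numP := by unfold numP; fun_prop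

@[fun_prop]
theorem primrec_numD : Primrec numD := by unfold numD; fun_prop

@[fun_prop]
theorem primrec_kMax : Primrec kMax := by unfold kMax; fun_prop

@[fun_prop]
theorem primrec_leftEnd {e t : α → ℕ} (he : Primrec e) (ht : Primrec t) :
    Primrec fun a => leftEnd (e a) (t a) := by
  unfold leftEnd; fun_prop

@[fun_prop]
theorem primrec_rightEnd {e t i : α → ℕ} (he : Primrec e) (ht : Primrec t) (hi : Primrec i) :
    Primrec fun a => rightEnd (e a) (t a) (i a) := by
  unfold rightEnd; fun_prop

@[fun_prop]
theorem primrec_colour {e w x t : α → ℕ} (he : Primrec e) (hw : Primrec w) (hx : Primrec x)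
    (ht : Primrec t) : Primrec fun a => colour (e a) (w a) (x a) (t a) := by
  unfold colour; fun_prop

theorem primrecPred_linked {e f p y : α → ℕ} (he : Primrec e) (hf : Primrec f) (hp : Primrec p)
    (hy : Primrec y) : PrimrecPred fun a => Linked (e a) (f a) (p a) (y a) :=
  primrecPred_exists_lt (primrecPred_eq (by fun_prop) (by fun_prop)) (by fun_prop)

theorem primrecPred_inLevel {e H k u : α → ℕ} (he : Primrec e) (hH : Primrec H) (hk : Primrec k)
    (hu : Primrec u) : PrimrecPred fun a => InLevel (e a) (H a) (k a) (u a) :=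
  primrecPred_eq (by fun_prop) (by fun_prop)

@[fun_prop]
theorem primrec_levelCard {e H k : α → ℕ} (he : Primrec e) (hH : Primrec H) (hk : Primrec k) :
    Primrec fun a => levelCard (e a) (H a) (k a) := by
  classical
  exact primrec_count (primrecPred_inLevel (by fun_prop) (by fun_prop) (by fun_prop) (by fun_prop))
    (by fun_prop)

@[fun_prop]
theorem primrec_linkCount {e H f k y z : α → ℕ} (he : Primrec e) (hH : Primrec H)
    (hf : Primrec f) (hk : Primrec k) (hy : Primrec y) (hz : Primrec z) :
    Primrec fun a => linkCount (e a) (H a) (f a) (k a) (y a) (z a) := by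
  classical
  refine primrec_count (.and (primrecPred_inLevel ?_ ?_ ?_ ?_)
    (.and (primrecPred_linked ?_ ?_ ?_ ?_) (primrecPred_linked ?_ ?_ ?_ ?_))) ?_ <;> fun_prop

theorem primrecPred_heavy {e H f y z : α → ℕ} (he : Primrec e) (hH : Primrec H) (hf : Primrec f)
    (hy : Primrec y) (hz : Primrec z) :
    PrimrecPred fun a => Heavy (e a) (H a) (f a) (y a) (z a) := by
  refine primrecPred_exists_lt (.and (primrecPred_le ?_ ?_)
    (.and (primrecPred_lt ?_ ?_) (primrecPred_le ?_ ?_))) ?_ <;> fun_prop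

theorem primrecPred_goodFamily : PrimrecPred fun a : ℕ × ℕ => GoodFamily a.1 a.2 := by
  classical
  refine primrecPred_forall_lt (primrecPred_exists_lt (primrecPred_forall_lt
    (primrecPred_le (primrec_mul (by fun_prop) (primrec_count (primrecPred_heavy ?_ ?_ ?_ ?_ ?_)
      ?_)) ?_) ?_) ?_) ?_ <;> fun_prop

end Primrec

open Finset

/-! ### Union bound -/

section UnionBound

variable {T X Ω Φ : Type*} [Fintype T] [DecidableEq T] [Fintype X] [DecidableEq X] [Fintype Ω]
  [Fintype Φ] {D : ℕ}

/-- A Chernoff bound for colourings: if on average at most every `255`-th colour is forbidden,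
then few colourings use forbidden colours at more than half of the points. -/
theorem card_many_forbidden (hD : 0 < D) (b : T → Finset (Fin D))
    (hb : 255 * ∑ t, #(b t) ≤ D * Fintype.card T) :
    #{f : T → Fin D | Fintype.card T < 2 * #{t | f t ∈ b t}} * 4 ^ Fintype.card T ≤
      D ^ Fintype.card T := by
  set R := Fintype.card T
  -- exponential moments with base `256`
  have hmom : ∑ f : T → Fin D, (256 : ℕ) ^ #{t | f t ∈ b t} = ∏ t, (D + 255 * #(b t)) := by
    have h1 : ∀ t, D + 255 * #(b t) = ∑ i : Fin D, if i ∈ b t then 256 else 1 := by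
      intro t
      have : ∀ i : Fin D, (if i ∈ b t then 256 else 1) = 1 + if i ∈ b t then 255 else 0 := by
        intro i; split_ifs <;> rfl
      simp [this, sum_add_distrib, sum_ite_mem, mul_comm]
    simp_rw [h1]
    rw [prod_univ_sum, Fintype.piFinset_univ]
    refine sum_congr rfl fun f _ => ?_
    rw [prod_ite]
    simp
  have hlow : #{f : T → Fin D | R < 2 * #{t | f t ∈ b t}} * 16 ^ R ≤
      ∑ f : T → Fin D, (256 : ℕ) ^ #{t | f t ∈ b t} := by
    rw [← smul_eq_mul, ← sum_const]
    refine (sum_le_sum fun f hf => ?_).trans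
      (sum_le_sum_of_subset (subset_univ _))
    simp only [mem_filter, mem_univ, true_and] at hf
    calc 16 ^ R ≤ 16 ^ (2 * #{t | f t ∈ b t}) := Nat.pow_le_pow_right (by norm_num) hf.le
      _ = 256 ^ #{t | f t ∈ b t} := by rw [pow_mul]; norm_num
  have hup : (∏ t, (D + 255 * #(b t)) : ℕ) ≤ D ^ R * 4 ^ R := by
    have hD' : (0 : ℝ) < D := by exact_mod_cast hD
    have : (∏ t, (D + 255 * #(b t) : ℝ)) ≤ D ^ R * 4 ^ R := by
      calc (∏ t, (D + 255 * #(b t) : ℝ))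
          = ∏ t, ((D : ℝ) * (255 * #(b t) / D + 1)) := by
            refine prod_congr rfl fun t _ => ?_
            field_simp
            ring
        _ ≤ ∏ t, ((D : ℝ) * Real.exp (255 * #(b t) / D)) := by
            refine prod_le_prod (fun t _ => by positivity) fun t _ => ?_
            exact mul_le_mul_of_nonneg_left (Real.add_one_le_exp _) hD'.le
        _ = D ^ R * Real.exp (∑ t, 255 * #(b t) / D) := by
            rw [prod_mul_distrib, Real.exp_sum]; simp [R]
        _ ≤ D ^ R * Real.exp (R * 1) := by
            gcongr
            rw [← sum_div, ← mul_sum, div_le_iff₀ hD', mul_one, mul_comm (R : ℝ)]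
            exact_mod_cast hb
        _ ≤ D ^ R * 4 ^ R := by
            rw [Real.exp_nat_mul]
            gcongr
            exact Real.exp_one_lt_three.le.trans (by norm_num)
    exact_mod_cast this
  have h := hlow.trans (hmom.le.trans hup)
  have h16 : (16 : ℕ) ^ R = 4 ^ R * 4 ^ R := by rw [← mul_pow]; norm_num
  rw [h16, ← mul_assoc] at h
  exact Nat.le_of_mul_le_mul_right h (by positivity)

/-- The bound of `card_many_forbidden` survives a choice between at most `2 ^ |T|` systems of
forbidden colours. -/
theorem card_exists_many_forbidden (hD : 0 < D) (b : Φ → T → Finset (Fin D))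
    (hb : ∀ φ, 255 * ∑ t, #(b φ t) ≤ D * Fintype.card T)
    (hΦ : Fintype.card Φ ≤ 2 ^ Fintype.card T) :
    #{f : T → Fin D | ∃ φ, Fintype.card T < 2 * #{t | f t ∈ b φ t}} * 2 ^ Fintype.card T ≤
      D ^ Fintype.card T := by
  set R := Fintype.card T
  have hsub : ({f : T → Fin D | ∃ φ, R < 2 * #{t | f t ∈ b φ t}} : Finset _) ⊆
      univ.biUnion fun φ : Φ => ({f : T → Fin D | R < 2 * #{t | f t ∈ b φ t}} : Finset _) := by
    intro f; simp
  have h1 := (card_le_card hsub).trans card_biUnion_le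
  have h2 : (∑ φ : Φ, #{f : T → Fin D | R < 2 * #{t | f t ∈ b φ t}}) * 4 ^ R ≤
      2 ^ R * D ^ R := by
    rw [sum_mul]
    calc _ ≤ ∑ _φ : Φ, D ^ R := sum_le_sum fun φ _ => card_many_forbidden hD _ (hb φ)
      _ ≤ 2 ^ R * D ^ R := by simpa using Nat.mul_le_mul_right _ hΦ
  have h4 : (4 : ℕ) ^ R = 2 ^ R * 2 ^ R := by rw [← mul_pow]; norm_num
  have h3 := (Nat.mul_le_mul_right (4 ^ R) h1).trans h2
  rw [h4, ← mul_assoc, mul_comm (2 ^ R) (D ^ R)] at h3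
  exact Nat.le_of_mul_le_mul_right h3 (by positivity)

/-- If there are fewer than `2 ^ (|T| |X|)` adversaries, each with at most `2 ^ |T|` sparse systems
of forbidden colours, then some family of colourings indexed by `X` contains for every adversary a
colouring that none of the systems of this adversary spoils at more than half of the points. -/
theorem exists_family (hD : 0 < D) (b : Ω → Φ → T → Finset (Fin D))
    (hb : ∀ ω φ, 255 * ∑ t, #(b ω φ t) ≤ D * Fintype.card T)
    (hΦ : Fintype.card Φ ≤ 2 ^ Fintype.card T)
    (hΩ : Fintype.card Ω < 2 ^ (Fintype.card T * Fintype.card X)) :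
    ∃ g : X → T → Fin D, ∀ ω, ∃ x, ∀ φ, 2 * #{t | g x t ∈ b ω φ t} ≤ Fintype.card T := by
  classical
  by_contra! hcon
  set R := Fintype.card T
  have hsub : (univ : Finset (X → T → Fin D)) ⊆ univ.biUnion fun ω : Ω => Fintype.piFinset
      fun _ : X => ({f | ∃ φ, R < 2 * #{t | f t ∈ b ω φ t}} : Finset (T → Fin D)) := by
    intro g _
    simpa using hcon g
  have h1 := (card_le_card hsub).trans card_biUnion_le
  simp only [Fintype.card_piFinset, prod_const, card_univ, Fintype.card_fun, Fintype.card_fin] at h1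
  set N := Fintype.card X
  have h2 : (∑ ω, #{f : T → Fin D | ∃ φ, R < 2 * #{t | f t ∈ b ω φ t}} ^ N) * 2 ^ (R * N) ≤
      Fintype.card Ω * (D ^ R) ^ N := by
    rw [sum_mul, pow_mul]
    calc _ ≤ ∑ _ω : Ω, (D ^ R) ^ N := sum_le_sum fun ω _ => by
            rw [← mul_pow]
            exact Nat.pow_le_pow_left (card_exists_many_forbidden hD _ (hb ω) hΦ) _
      _ = _ := by simp
  have h3 := (Nat.mul_le_mul_right (2 ^ (R * N)) h1).trans h2
  have h4 : Fintype.card Ω * (D ^ R) ^ N < 2 ^ (R * N) * (D ^ R) ^ N :=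
    Nat.mul_lt_mul_of_pos_right hΩ (by positivity)
  rw [mul_comm] at h3
  exact lt_irrefl _ (h3.trans_lt h4)

end UnionBound

/-! ### Existence of good families -/

/-- Every function between initial segments of the natural numbers is coded by digits. -/
theorem exists_digit_eq {b : ℕ} (F : ℕ → ℕ) (hF : ∀ i, F i < b) (n : ℕ) :
    ∃ v < b ^ n, ∀ i < n, digit b v i = F i := by
  refine ⟨finFunctionFinEquiv fun i : Fin n => ⟨F i, hF i⟩, Fin.is_lt _, fun i hi => ?_⟩
  have h := finFunctionFinEquiv.symm_apply_apply fun i : Fin n => (⟨F i, hF i⟩ : Fin b)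
  have h' := congrArg Fin.val (congrFun h ⟨i, hi⟩)
  simpa [digit, finFunctionFinEquiv] using h'

theorem card_linked_le (e f p n : ℕ) [DecidablePred (Linked e f p)] :
    #{y ∈ range n | Linked e f p y} ≤ 2 ^ e := by
  calc _ ≤ #((range (2 ^ e)).image fun i => digit (2 ^ vLen e) f (p * 2 ^ e + i)) := by
        refine card_le_card fun y hy => ?_
        obtain ⟨i, hi, h⟩ := (mem_filter.1 hy).2
        exact mem_image.2 ⟨i, mem_range.2 hi, h⟩
    _ ≤ 2 ^ e := card_image_le.trans (by simp)

/-- Double counting: every pair of programs is linked to at most `2 ^ (2 * e)` pairs of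
vertices. -/
theorem sum_linkCount_le (e H f k n : ℕ) :
    ∑ c ∈ range n ×ˢ range n, linkCount e H f k c.1 c.2 ≤ levelCard e H k * 2 ^ (2 * e) := by
  classical
  have hl : ∀ c : ℕ × ℕ, linkCount e H f k c.1 c.2 =
      #{u ∈ {u ∈ range (numP e * numP e) | InLevel e H k u} |
        Linked e f (u / numP e) c.1 ∧ Linked e f (u % numP e) c.2} := by
    intro c
    rw [linkCount, Nat.count_eq_card_filter_range, filter_filter]
    congr 1
    ext u
    rw [mem_filter, mem_filter, PairLinked]
  have h := sum_card_bipartiteAbove_eq_sum_card_bipartiteBelow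
    (s := range n ×ˢ range n) (t := {u ∈ range (numP e * numP e) | InLevel e H k u})
    (r := fun c u => Linked e f (u / numP e) c.1 ∧ Linked e f (u % numP e) c.2)
  simp only [bipartiteAbove, bipartiteBelow] at h
  simp only [hl, levelCard, Nat.count_eq_card_filter_range]
  rw [h]
  refine (sum_le_card_nsmul _ _ (2 ^ (2 * e)) fun u _ => ?_).trans_eq (smul_eq_mul _ _)
  rw [filter_product, card_product, two_mul, pow_add]
  exact Nat.mul_le_mul (card_linked_le ..) (card_linked_le ..)

open Classical in
theorem card_heavy_le (e H f n : ℕ) :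
    #{c ∈ range n ×ˢ range n | Heavy e H f c.1 c.2} ≤ kMax e * 2 ^ (eLen e + e + 2 * e + 1) := by
  set S : ℕ → Finset (ℕ × ℕ) := fun k => {c ∈ range n ×ˢ range n | levelCard e H k ≤ 2 ^ (k + 1) ∧
    2 ^ k ≤ linkCount e H f k c.1 c.2 * 2 ^ (eLen e + e)}
  have hS : ∀ k, #(S k) ≤ 2 ^ (eLen e + e + 2 * e + 1) := by
    intro k
    by_cases hk : levelCard e H k ≤ 2 ^ (k + 1)
    · have h1 : #(S k) * 2 ^ k ≤
          (∑ c ∈ range n ×ˢ range n, linkCount e H f k c.1 c.2) * 2 ^ (eLen e + e) := by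
        rw [← smul_eq_mul, ← sum_const, sum_mul]
        refine (sum_le_sum fun c hc => ?_).trans (sum_le_sum_of_subset (filter_subset _ _))
        exact (mem_filter.1 hc).2.2
      have h2 := Nat.mul_le_mul_right (2 ^ (eLen e + e))
        ((sum_linkCount_le e H f k n).trans (Nat.mul_le_mul_right _ hk))
      refine Nat.le_of_mul_le_mul_right ((h1.trans h2).trans_eq ?_) (Nat.two_pow_pos k)
      ring
    · simp [S, hk]
  calc _ ≤ #((range (kMax e)).biUnion S) := by
        refine card_le_card fun c hc => ?_
        obtain ⟨hc, k, hk, h1, -, h2⟩ := mem_filter.1 hc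
        exact mem_biUnion.2 ⟨k, mem_range.2 hk, mem_filter.2 ⟨hc, h1, h2⟩⟩
    _ ≤ ∑ k ∈ range (kMax e), #(S k) := card_biUnion_le
    _ ≤ _ := by simpa using sum_le_card_nsmul (range (kMax e)) _ _ fun k _ => hS k

theorem vLen_eq (e : ℕ) : vLen e = dLen e + (4 * e + 16) := by unfold vLen dLen; omega

theorem numD_eq (e : ℕ) : numD e = 2 ^ (4 * e + 16) := by
  rw [numD, vLen_eq, Nat.add_sub_cancel_left]

theorem numD_pos (e : ℕ) : 0 < numD e := Nat.two_pow_pos _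

theorem two_pow_vLen (e : ℕ) : 2 ^ vLen e = 2 ^ dLen e * numD e := by
  rw [numD_eq, vLen_eq, pow_add]

theorem leftEnd_lt {e t : ℕ} (ht : t < 2 ^ eLen e) : leftEnd e t < 2 ^ vLen e := by
  unfold leftEnd
  rwa [Nat.div_lt_iff_lt_mul (Nat.two_pow_pos _), ← pow_add]

theorem rightEnd_lt {e t i : ℕ} (hi : i < numD e) : rightEnd e t i < 2 ^ vLen e := by
  unfold rightEnd
  rw [two_pow_vLen]
  have h := Nat.mod_lt t (Nat.two_pow_pos (dLen e))
  calc t % 2 ^ dLen e * numD e + i < (t % 2 ^ dLen e + 1) * numD e := by rw [add_mul]; omega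
    _ ≤ _ := Nat.mul_le_mul_right _ h

/-- Different numbers or colours of edges give different edges. -/
theorem edge_injective {e t t' i i' : ℕ} (hi : i < numD e) (hi' : i' < numD e)
    (h1 : leftEnd e t = leftEnd e t') (h2 : rightEnd e t i = rightEnd e t' i') :
    t = t' ∧ i = i' := by
  have hd := congrArg (· / numD e) h2
  have hm := congrArg (· % numD e) h2
  simp only [rightEnd, mul_comm _ (numD e), Nat.mul_add_div (numD_pos e), Nat.div_eq_of_lt hi,
    Nat.div_eq_of_lt hi', Nat.mul_add_mod, Nat.mod_eq_of_lt hi, Nat.mod_eq_of_lt hi',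
    add_zero] at hd hm
  refine ⟨?_, hm⟩
  rw [← Nat.div_add_mod t (2 ^ dLen e), ← Nat.div_add_mod t' (2 ^ dLen e), hd]
  unfold leftEnd at h1
  rw [h1]

open Classical in
/-- The expected number of heavy edges is small compared with the number of edges. -/
theorem sum_card_heavy_le (e H f : ℕ) :
    255 * ∑ t : Fin (2 ^ eLen e), #{i : Fin (numD e) | Heavy e H f (leftEnd e t) (rightEnd e t i)} ≤
      numD e * 2 ^ eLen e := by
  have h1 : ∑ t : Fin (2 ^ eLen e),
      #{i : Fin (numD e) | Heavy e H f (leftEnd e t) (rightEnd e t i)} ≤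
      #{c ∈ range (2 ^ vLen e) ×ˢ range (2 ^ vLen e) | Heavy e H f c.1 c.2} := by
    rw [← card_sigma]
    refine card_le_card_of_injOn (fun s => (leftEnd e s.1, rightEnd e s.1 s.2)) ?_ ?_
    · rintro ⟨t, i⟩ h
      simp only [coe_sigma, Set.mem_sigma_iff, coe_filter, mem_univ, true_and, Set.mem_ofPred_eq,
        coe_univ, Set.mem_univ] at h
      simp only [coe_filter, mem_product, mem_range, Set.mem_ofPred_eq]
      exact ⟨⟨leftEnd_lt t.2, rightEnd_lt i.2⟩, h⟩
    · rintro ⟨t, i⟩ _ ⟨t', i'⟩ _ h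
      simp only [Prod.mk.injEq] at h
      obtain ⟨h1, h2⟩ := edge_injective i.2 i'.2 h.1 h.2
      rw [Fin.ext h1, Fin.ext h2]
  have h2 := h1.trans (card_heavy_le e H f _)
  have h3 : 510 * kMax e ≤ 2 ^ (e + 16) := by
    have he : e < 2 ^ e := Nat.lt_two_pow_self
    have : kMax e = 27 * e + 88 := by unfold kMax eLen vLen dLen; ring
    rw [this, pow_add]
    omega
  calc _ ≤ 255 * (kMax e * 2 ^ (eLen e + e + 2 * e + 1)) := Nat.mul_le_mul_left _ h2
    _ = 510 * kMax e * (2 ^ (3 * e) * 2 ^ eLen e) := by ring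
    _ ≤ 2 ^ (e + 16) * (2 ^ (3 * e) * 2 ^ eLen e) := Nat.mul_le_mul_right _ h3
    _ = _ := by rw [numD_eq]; ring

/-- Good families exist: a random family is good with positive probability. -/
theorem exists_goodFamily (e : ℕ) : ∃ w, GoodFamily e w := by
  classical
  have he : e < 2 ^ e := Nat.lt_two_pow_self
  -- there are few ways to link the programs to vertices, because a program has few links and
  -- the degree of the graphs is large
  have hΦ : vLen e * (numP e * 2 ^ e) ≤ 2 ^ eLen e := by
    have h : vLen e ≤ 2 ^ (e + 10) := by rw [pow_add, vLen]; omega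
    calc vLen e * (numP e * 2 ^ e) ≤ 2 ^ (e + 10) * (numP e * 2 ^ e) :=
          Nat.mul_le_mul_right _ h
      _ = 2 ^ eLen e := by unfold numP eLen dLen vLen; ring
  -- there are few sets of pairs, because the number of graphs is large
  have hΩ : kMax e * (numP e * numP e) < 2 ^ eLen e * 2 ^ xLen e := by
    have h : kMax e < 2 ^ (2 * e + 10) := by
      have : kMax e = 27 * e + 88 := by unfold kMax eLen vLen dLen; ring
      have : 2 ^ e ≤ 2 ^ (2 * e) := Nat.pow_le_pow_right two_pos (by omega)
      rw [pow_add]; omega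
    calc kMax e * (numP e * numP e) < 2 ^ (2 * e + 10) * (numP e * numP e) :=
          Nat.mul_lt_mul_of_pos_right h (by unfold numP; positivity)
      _ = 2 ^ eLen e * 2 ^ xLen e := by unfold numP eLen dLen vLen xLen; ring
  obtain ⟨g, hg⟩ := exists_family (X := Fin (2 ^ xLen e))
    (Ω := Fin (2 ^ (kMax e * (numP e * numP e))))
    (Φ := Fin ((2 ^ vLen e) ^ (numP e * 2 ^ e))) (numD_pos e)
    (fun H f (t : Fin (2 ^ eLen e)) =>
      {i : Fin (numD e) | Heavy e H f (leftEnd e t) (rightEnd e t i)})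
    (fun H f => by rw [Fintype.card_fin]; exact sum_card_heavy_le e H f)
    (by
      rw [Fintype.card_fin, Fintype.card_fin, ← pow_mul]
      exact Nat.pow_le_pow_right two_pos hΦ)
    (by
      rw [Fintype.card_fin, Fintype.card_fin, Fintype.card_fin]
      exact Nat.pow_lt_pow_right one_lt_two hΩ)
  have hR : 0 < 2 ^ eLen e := Nat.two_pow_pos _
  obtain ⟨w, -, hw⟩ := exists_digit_eq (b := numD e)
    (fun n => if h : n / 2 ^ eLen e < 2 ^ xLen e then
      (g ⟨n / 2 ^ eLen e, h⟩ ⟨n % 2 ^ eLen e, Nat.mod_lt _ hR⟩ : ℕ) else 0)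
    (fun n => by split_ifs; exacts [Fin.is_lt _, numD_pos e])
    (2 ^ xLen e * 2 ^ eLen e)
  refine ⟨w, fun H hH => ?_⟩
  obtain ⟨x, hx⟩ := hg ⟨H, hH⟩
  refine ⟨x, x.2, fun f hf => ?_⟩
  have hcol : ∀ t (ht : t < 2 ^ eLen e), colour e w x t = g x ⟨t, ht⟩ := by
    intro t ht
    have hlt : (x : ℕ) * 2 ^ eLen e + t < 2 ^ xLen e * 2 ^ eLen e := by
      calc (x : ℕ) * 2 ^ eLen e + t < (x + 1) * 2 ^ eLen e := by rw [add_mul]; omega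
        _ ≤ _ := Nat.mul_le_mul_right _ x.2
    have hdiv : ((x : ℕ) * 2 ^ eLen e + t) / 2 ^ eLen e = x := by
      rw [mul_comm, Nat.mul_add_div hR, Nat.div_eq_of_lt ht, add_zero]
    have hmod : ((x : ℕ) * 2 ^ eLen e + t) % 2 ^ eLen e = t := by
      rw [mul_comm, Nat.mul_add_mod, Nat.mod_eq_of_lt ht]
    rw [colour, hw _ hlt]
    simp only [hdiv, hmod, x.2, dif_pos]
  have h := hx ⟨f, hf⟩
  rw [Fintype.card_fin] at h
  refine le_trans (Nat.mul_le_mul_left 2 ?_) h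
  rw [Nat.count_eq_card_filter_range]
  refine card_le_card_of_surjOn (fun t : Fin (2 ^ eLen e) => (t : ℕ)) fun t ht => ?_
  simp only [coe_filter, mem_range, Set.mem_ofPred_eq] at ht
  refine ⟨⟨t, ht.1⟩, ?_, rfl⟩
  simpa [← hcol t ht.1] using ht.2

/-! ### Enumerations without repetition -/

section Enumeration

variable {β γ σ : Type*} [Primcodable β] [Primcodable γ] [Primcodable σ]

/-- The values of a partial recursive function, the first argument being arbitrary, are listed by a
primitive recursive function. -/
theorem exists_primrec_listing {f : β → γ →. σ} (hf : Partrec₂ f) :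
    ∃ F : γ → ℕ → Option σ, Primrec₂ F ∧ ∀ c s, (∃ b, s ∈ f b c) ↔ ∃ n, F c n = some s := by
  obtain ⟨cf, hcf⟩ := Nat.Partrec.Code.exists_code.1 hf
  refine ⟨fun c n => (Encodable.decode (α := β) n.unpair.2).bind fun b =>
    (Nat.Partrec.Code.evaln n.unpair.1 cf (Encodable.encode (b, c))).bind Encodable.decode, ?_, ?_⟩
  · refine Primrec.option_bind (Primrec.decode.comp
      (Primrec.snd.comp (Primrec.unpair.comp Primrec.snd))) ?_
    refine Primrec.option_bind ?_ (Primrec.decode.comp Primrec.snd)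
    exact Nat.Partrec.Code.primrec_evaln.comp
      (f := fun a => Nat.Partrec.Code.evaln a.1.1 a.1.2 a.2)
      (g := fun a : (γ × ℕ) × β => ((a.1.2.unpair.1, cf), Encodable.encode (a.2, a.1.1)))
      (Primrec.pair (Primrec.pair (Primrec.fst.comp (Primrec.unpair.comp
          (Primrec.snd.comp Primrec.fst))) (Primrec.const cf))
        (Primrec.encode.comp (Primrec.pair Primrec.snd (Primrec.fst.comp Primrec.fst))))
  · have heval : ∀ b c m, m ∈ cf.eval (Encodable.encode (b, c)) ↔
        ∃ s ∈ f b c, Encodable.encode s = m := by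
      intro b c m
      rw [hcf]
      simp
    intro c s
    constructor
    · rintro ⟨b, hb⟩
      obtain ⟨k, hk⟩ := Nat.Partrec.Code.evaln_complete.1 ((heval b c _).2 ⟨s, hb, rfl⟩)
      refine ⟨Nat.pair k (Encodable.encode b), ?_⟩
      simp only [Nat.unpair_pair, Encodable.encodek, Option.bind_some]
      rw [Option.mem_def.1 hk, Option.bind_some, Encodable.encodek]
    · rintro ⟨n, hn⟩
      obtain ⟨b, -, hb⟩ := Option.bind_eq_some_iff.1 hn
      obtain ⟨m, hm, hs⟩ := Option.bind_eq_some_iff.1 hb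
      obtain ⟨s', hs', rfl⟩ := (heval b c m).1 (Nat.Partrec.Code.evaln_sound hm)
      rw [Encodable.encodek, Option.some_inj] at hs
      exact ⟨b, hs ▸ hs'⟩

/-- A recursively enumerable set that is known to have at most `N` elements can be enumerated
without repetitions, so that its elements are named by the numbers below `N`. -/
theorem exists_enumeration {f : β → γ →. σ} (hf : Partrec₂ f) :
    ∃ h : γ → ℕ →. σ, Partrec₂ h ∧ ∀ c (S : Finset σ), (∀ b, ∀ s ∈ f b c, s ∈ S) →
      ∀ b, ∀ s ∈ f b c, ∃ i < #S, s ∈ h c i := by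
  classical
  obtain ⟨F, hF, hfF⟩ := exists_primrec_listing hf
  -- the stages at which a new value appears
  set New : γ → ℕ → Prop := fun c n => (F c n).isSome = true ∧ ∀ m < n, F c m ≠ F c n
  have hFc : ∀ {α : Type _} [Primcodable α] {u : α → γ} {v : α → ℕ}, Primrec u → Primrec v →
      Primrec fun a => F (u a) (v a) := fun hu hv => hF.comp hu hv
  have hNewP : ∀ {α : Type _} [Primcodable α] {u : α → γ} {v : α → ℕ}, Primrec u → Primrec v →
      PrimrecPred fun a => New (u a) (v a) := by
    intro α _ u v hu hv
    refine .and (Primrec.eq.comp (Primrec.option_isSome.comp (hFc hu hv)) (.const true))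
      (primrecPred_forall_lt (.not (Primrec.eq.comp (hFc ?_ ?_) (hFc ?_ ?_))) hv) <;> fun_prop
  refine ⟨fun c i => Nat.rfindOpt fun n =>
    if New c n ∧ Nat.count (New c) n = i then F c n else none, ?_, ?_⟩
  · refine Partrec.rfindOpt (f := fun (a : γ × ℕ) n =>
      if New a.1 n ∧ Nat.count (New a.1) n = a.2 then F a.1 n else none) (Primrec.to_comp ?_)
    refine Primrec.ite (.and (hNewP ?_ ?_) (primrecPred_eq (primrec_count (hNewP ?_ ?_) ?_) ?_))
      (hFc ?_ ?_) (.const none) <;> fun_prop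
  · intro c S hS b s hs
    have hex : ∃ n, F c n = some s := (hfF c s).1 ⟨b, hs⟩
    obtain ⟨n, hn, hmin⟩ : ∃ n, F c n = some s ∧ ∀ m < n, F c m ≠ some s :=
      ⟨Nat.find hex, Nat.find_spec hex, fun m => Nat.find_min hex⟩
    have hnew : New c n := ⟨by simp [hn], fun m hm => hn ▸ hmin m hm⟩
    refine ⟨Nat.count (New c) n, ?_, ?_⟩
    · rw [← Nat.add_one_le_iff, ← Nat.count_succ_eq_succ_count hnew,
        Nat.count_eq_card_filter_range,
        ← card_map (s := S) Function.Embedding.some]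
      refine card_le_card_of_injOn (F c) ?_ ?_
      · intro m hm
        obtain ⟨v, hv⟩ := Option.isSome_iff_exists.1 (mem_filter.1 hm).2.1
        obtain ⟨b', hb'⟩ := (hfF c v).2 ⟨m, hv⟩
        simpa [hv] using hS b' v hb'
      · intro m hm m' hm' heq
        rcases lt_trichotomy m m' with h | h | h
        · exact absurd heq ((mem_filter.1 hm').2.2 m h)
        · exact h
        · exact absurd heq.symm ((mem_filter.1 hm).2.2 m' h)
    · have hdom : (Nat.rfindOpt fun m =>
          if New c m ∧ Nat.count (New c) m = Nat.count (New c) n then F c m else none).Dom :=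
        Nat.rfindOpt_dom.2 ⟨n, s, by simp [hnew, hn]⟩
      obtain ⟨v, hv⟩ := Part.dom_iff_mem.1 hdom
      obtain ⟨m, hm⟩ := Nat.rfindOpt_spec hv
      rw [Option.mem_def] at hm
      split_ifs at hm with hc
      obtain rfl := Nat.count_injective hc.1 hnew hc.2
      rw [hn, Option.some_inj] at hm
      rwa [hm]

end Enumeration

/-! ### Strings and complexity -/

/-- The number with binary digits `s`, the least significant one first. -/
def val (s : Str) : ℕ := s.foldr (fun b n => 2 * n + b.toNat) 0

@[simp]
theorem val_nil : val [] = 0 := rfl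

@[simp]
theorem val_cons (b : Bool) (s : Str) : val (b :: s) = 2 * val s + b.toNat := rfl

theorem val_lt (s : Str) : val s < 2 ^ s.length := by
  induction s with
  | nil => simp
  | cons b s ih =>
    have := b.toNat_lt
    rw [val_cons, List.length_cons, pow_succ]
    omega

theorem exists_val_eq {n m : ℕ} (h : n < 2 ^ m) : ∃ s : Str, s.length = m ∧ val s = n := by
  induction m generalizing n with
  | zero => exact ⟨[], rfl, by simp at h; simp [h]⟩
  | succ m ih =>
    obtain ⟨s, hs, hv⟩ := ih (n := n / 2) (by rw [pow_succ] at h; omega)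
    refine ⟨decide (n % 2 = 1) :: s, by simp [hs], ?_⟩
    rw [val_cons, hv]
    rcases Nat.mod_two_eq_zero_or_one n with h2 | h2 <;> simp [h2] <;> omega

theorem pair_injective {p q p' q' : Str} (h : pair p q = pair p' q') : p = p' ∧ q = q' := by
  have hlen : ∀ (n n' : ℕ) (a a' : Str), List.replicate n false ++ true :: a =
      List.replicate n' false ++ true :: a' → n = n' ∧ a = a' := by
    intro n
    induction n with
    | zero => intro n' a a' h; cases n' <;> simp_all [List.replicate_succ]
    | succ n ih =>
      intro n' a a' h
      cases n' with
      | zero => simp [List.replicate_succ] at h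
      | succ n' =>
        simp only [List.replicate_succ, List.cons_append, List.cons.injEq, true_and] at h
        obtain ⟨h1, h2⟩ := ih _ _ _ h
        exact ⟨by rw [h1], h2⟩
  obtain ⟨h1, h2⟩ := hlen _ _ _ _ h
  exact List.append_inj h2 h1

@[fun_prop]
theorem primrec_val : Primrec val :=
  (Primrec.list_foldr Primrec.id (.const 0)
    (h := fun (_ : Str) (a : Bool × ℕ) => 2 * a.2 + a.1.toNat) (primrec_add (by fun_prop)
      ((Primrec.dom_bool Bool.toNat).comp (Primrec.fst.comp Primrec.snd)))).of_eq fun _ => rfl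

@[fun_prop]
theorem primrec_pair {α : Type*} [Primcodable α] {f g : α → Str} (hf : Primrec f)
    (hg : Primrec g) : Primrec fun a => pair (f a) (g a) := by
  have h : Primrec fun s : Str => List.replicate s.length false :=
    (Primrec.list_map (Primrec.list_range.comp Primrec.list_length)
      (g := fun _ _ => false) (Primrec.const false)).of_eq fun s => by
        simp [List.map_const']
  exact Primrec.list_append.comp (h.comp hf)
    (Primrec.list_cons.comp (.const true) (Primrec.list_append.comp hf hg))

attribute [fun_prop] Primrec.list_length

section Complexity

variable {U : Str → Str →. Str}

theorem condC_le {x y p : Str} (h : x ∈ U p y) : condC U x y ≤ p.length :=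
  Nat.sInf_le ⟨p, rfl, h⟩

theorem card_strings_lt (n : ℕ) :
    ∃ P : Finset Str, #P < 2 ^ n ∧ ∀ p : Str, p.length < n → p ∈ P := by
  induction n with
  | zero => exact ⟨∅, by simp⟩
  | succ n ih =>
    obtain ⟨P, hP, h⟩ := ih
    refine ⟨insert [] (P.image (List.cons false) ∪ P.image (List.cons true)), ?_, ?_⟩
    · have h1 := card_insert_le ([] : Str) (P.image (List.cons false) ∪ P.image (List.cons true))
      have h2 := card_union_le (P.image (List.cons false)) (P.image (List.cons true))
      have h3 := card_image_le (s := P) (f := List.cons false)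
      have h4 := card_image_le (s := P) (f := List.cons true)
      rw [pow_succ]
      omega
    · rintro (_ | ⟨_ | _, p⟩) hp <;> simp at hp ⊢ <;> exact h p (by omega)

/-- Fewer than `2 ^ n` strings have complexity less than `n`. -/
theorem IsOptimal.exists_finset_condC_lt (hU : IsOptimal U) (y : Str) (n : ℕ) :
    ∃ L : Finset Str, #L < 2 ^ n ∧ ∀ s, s ∈ L ↔ condC U s y < n := by
  classical
  obtain ⟨P, hP, hlt⟩ := card_strings_lt n
  choose g hg using fun s => hU.exists_shortest s y
  have hinj : Function.Injective g := fun s s' h =>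
    Part.mem_unique (hg s).2 (by rw [h]; exact (hg s').2)
  refine ⟨{s ∈ P.preimage g hinj.injOn | condC U s y < n}, ?_, fun s => ?_⟩
  · refine (card_filter_le _ _).trans_lt (lt_of_le_of_lt ?_ hP)
    rw [← card_image_of_injective _ hinj]
    exact card_le_card (image_subset_iff.2 fun s hs => mem_preimage.1 hs)
  · simp only [mem_filter, mem_preimage, and_iff_right_iff_imp]
    intro h
    exact hlt _ (by rwa [(hg s).1])

/-- A finite set of strings is listed without repetitions. -/
theorem exists_listing (L : Finset Str) : ∃ g : ℕ → Str, (∀ s ∈ L, ∃ i < #L, g i = s) ∧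
    ∀ i < #L, g i ∈ L ∧ ∀ j < #L, g i = g j → i = j := by
  refine ⟨fun i => if h : i < #L then L.equivFin.symm ⟨i, h⟩ else [], fun s hs => ?_,
    fun i hi => ⟨?_, fun j hj h => ?_⟩⟩
  · exact ⟨L.equivFin ⟨s, hs⟩, Fin.is_lt _, by simp⟩
  · simp [hi]
  · simpa [hi, hj] using h

theorem IsOptimal.exists_const_condC_le_length (hU : IsOptimal U) :
    ∃ c, ∀ x y, condC U x y ≤ x.length + c := by
  obtain ⟨t, ht⟩ := hU.2 (fun p _ => Part.some p)
    ((Computable.fst (α := Str) (β := Str)).partrec)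
  refine ⟨t.length, fun x y => ?_⟩
  have h : x ∈ U (t ++ x) y := by rw [ht]; exact Part.mem_some x
  simpa [add_comm] using condC_le h

end Complexity

/-! ### The short description of a linked pair of programs -/

theorem exists_computable_family : ∃ w : ℕ → ℕ, Computable w ∧ ∀ e, GoodFamily e (w e) := by
  classical
  exact ⟨_, Computable.find primrecPred_goodFamily.computablePred exists_goodFamily,
    fun e => Nat.find_spec (exists_goodFamily e)⟩

section Main

variable {U : Str → Str →. Str}

/-- A program for `[p, q]` together with witnesses that `p` and `q` have complexity less than
`vLen e + e` and are linked to vertices `y` and `z`: the five strings are programs for `[p, q]`,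
`p` and `q`, and programs that compute `y` and `z` from `[p, x]` and `[q, x]`. -/
abbrev Witness : Type := Str × Str × Str × Str × Str

/-- The data relative to which linked pairs are enumerated: the parameter `e`, the bound `k` for the
complexity of the pair, the numbers of the vertices `y` and `z`, and the string `x`. -/
abbrev Datum : Type := ℕ × ℕ × ℕ × ℕ × Str

/-- The programs of the witness are as short as the bounds on the complexities demand. -/
def lengthsOk (b : Witness) (c : Datum) : Prop :=
  b.1.length ≤ c.2.1 ∧ b.2.1.length < vLen c.1 + c.1 ∧ b.2.2.1.length < vLen c.1 + c.1 ∧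
    b.2.2.2.1.length < c.1 ∧ b.2.2.2.2.length < c.1

/-- The final test of the verification of a witness, once all programs have halted with the outputs
`o`, `p`, `q`, `y`, `z`. -/
def outputsOk (b : Witness) (c : Datum) (o p q y z : Str) : Prop :=
  lengthsOk b c ∧ o = pair p q ∧ y.length = vLen c.1 ∧ z.length = vLen c.1 ∧ val y = c.2.2.1 ∧
    val z = c.2.2.2.1

open Classical in
/-- Verification of a witness, with the pair `[p, q]` as the result. -/
noncomputable def verify (U : Str → Str →. Str) (b : Witness) (c : Datum) : Part Str :=
  (U b.1 []).bind fun o => (U b.2.1 []).bind fun p => (U b.2.2.1 []).bind fun q =>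
    (U b.2.2.2.1 (pair p c.2.2.2.2)).bind fun y => (U b.2.2.2.2 (pair q c.2.2.2.2)).bind fun z =>
      ((if outputsOk b c o p q y z then some o else none : Option Str) : Part Str)

theorem primrecPred_lengthsOk : PrimrecPred fun a : Witness × Datum => lengthsOk a.1 a.2 := by
  refine .and (primrecPred_le ?_ ?_) (.and (primrecPred_lt ?_ ?_) (.and (primrecPred_lt ?_ ?_)
    (.and (primrecPred_lt ?_ ?_) (primrecPred_lt ?_ ?_)))) <;> fun_prop

theorem primrecPred_outputsOk :
    PrimrecPred fun a : (Witness × Datum) × Str × Str × Str × Str × Str =>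
      outputsOk a.1.1 a.1.2 a.2.1 a.2.2.1 a.2.2.2.1 a.2.2.2.2.1 a.2.2.2.2.2 := by
  refine .and (primrecPred_lengthsOk.comp .fst) (.and (Primrec.eq.comp ?_ ?_)
    (.and (primrecPred_eq ?_ ?_) (.and (primrecPred_eq ?_ ?_)
    (.and (primrecPred_eq ?_ ?_) (primrecPred_eq ?_ ?_))))) <;> fun_prop

theorem partrec_verify (hU : IsLanguage U) : Partrec₂ (verify U) := by
  classical
  have hU' : ∀ {α : Type} [Primcodable α] {f g : α → Str}, Primrec f → Primrec g →
      Partrec fun a => U (f a) (g a) := fun hf hg => Partrec₂.comp hU hf.to_comp hg.to_comp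
  have hlast : Primrec fun a : (Witness × Datum) × Str × Str × Str × Str × Str =>
      if outputsOk a.1.1 a.1.2 a.2.1 a.2.2.1 a.2.2.2.1 a.2.2.2.2.1 a.2.2.2.2.2
        then some a.2.1 else none :=
    .ite primrecPred_outputsOk (Primrec.option_some.comp (by fun_prop)) (.const none)
  have h := hlast.to_comp.ofOption
  unfold verify
  refine Partrec.bind (hU' (by fun_prop) (by fun_prop)) ?_
  refine Partrec.bind (hU' (by fun_prop) (by fun_prop)) ?_
  refine Partrec.bind (hU' (by fun_prop) (by fun_prop)) ?_
  refine Partrec.bind (hU' (by fun_prop) (by fun_prop)) ?_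
  refine Partrec.bind (hU' (by fun_prop) (by fun_prop)) ?_
  refine h.comp (g := fun a : (((((Witness × Datum) × Str) × Str) × Str) × Str) × Str =>
    (a.1.1.1.1.1, a.1.1.1.1.2, a.1.1.1.2, a.1.1.2, a.1.2, a.2)) (Primrec.to_comp ?_)
  fun_prop

theorem mem_verify {b : Witness} {c : Datum} {s : Str} :
    s ∈ verify U b c ↔ ∃ p q y z, s ∈ U b.1 [] ∧ p ∈ U b.2.1 [] ∧ q ∈ U b.2.2.1 [] ∧
      y ∈ U b.2.2.2.1 (pair p c.2.2.2.2) ∧ z ∈ U b.2.2.2.2 (pair q c.2.2.2.2) ∧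
      outputsOk b c s p q y z := by
  classical
  simp only [verify, Part.mem_bind_iff, Part.mem_coe, Option.mem_def]
  constructor
  · rintro ⟨o, ho, p, hp, q, hq, y, hy, z, hz, h⟩
    split_ifs at h with hc
    obtain rfl := Option.some_inj.1 h
    exact ⟨p, q, y, z, ho, hp, hq, hy, hz, hc⟩
  · rintro ⟨p, q, y, z, ho, hp, hq, hy, hz, hc⟩
    exact ⟨s, ho, p, hp, q, hq, y, hy, z, hz, if_pos hc⟩

/-- `[p, q]` is a result of the verification for a suitable witness exactly if `p` and `q` are
simple and linked to the given vertices. -/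
theorem IsOptimal.exists_mem_verify_iff (hU : IsOptimal U) {e k u v : ℕ} {x s : Str} :
    (∃ b, s ∈ verify U b (e, k, u, v, x)) ↔ ∃ p q y z : Str, s = pair p q ∧
      plainC U (pair p q) ≤ k ∧ plainC U p < vLen e + e ∧ plainC U q < vLen e + e ∧
      condC U y (pair p x) < e ∧ condC U z (pair q x) < e ∧
      y.length = vLen e ∧ z.length = vLen e ∧ val y = u ∧ val z = v := by
  constructor
  · rintro ⟨b, h⟩
    obtain ⟨p, q, y, z, ho, hp, hq, hy, hz, ⟨h1, h2, h3, h4, h5⟩, rfl, h7⟩ := mem_verify.1 h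
    exact ⟨p, q, y, z, rfl, (condC_le ho).trans h1, (condC_le hp).trans_lt h2,
      (condC_le hq).trans_lt h3, (condC_le hy).trans_lt h4, (condC_le hz).trans_lt h5, h7⟩
  · rintro ⟨p, q, y, z, rfl, h1, h2, h3, h4, h5, h7⟩
    obtain ⟨r, hr, hr'⟩ := hU.exists_shortest (pair p q) []
    obtain ⟨r₁, hr₁, hr₁'⟩ := hU.exists_shortest p []
    obtain ⟨r₂, hr₂, hr₂'⟩ := hU.exists_shortest q []
    obtain ⟨i, hi, hi'⟩ := hU.exists_shortest y (pair p x)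
    obtain ⟨j, hj, hj'⟩ := hU.exists_shortest z (pair q x)
    exact ⟨(r, r₁, r₂, i, j), mem_verify.2 ⟨p, q, y, z, hr', hr₁', hr₂', hi', hj',
      ⟨hr.trans_le h1, hr₁.trans_lt h2, hr₂.trans_lt h3, hi.trans_lt h4, hj.trans_lt h5⟩, rfl, h7⟩⟩

/-- A pair of programs linked to an edge of the graph number `val x` has, given `x`, a description
that consists of the number of the edge and the number of the pair among those linked to the
edge. -/
theorem IsOptimal.exists_const_condC_pair_le (hU : IsOptimal U) {w : ℕ → ℕ} (hw : Computable w) :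
    ∃ c : ℕ, ∀ (e k n t : ℕ) (x : Str) (S : Finset Str), x.length = xLen e → t < 2 ^ eLen e →
      eLen e + n + e = k → #S ≤ 2 ^ n →
      (∀ b, ∀ s ∈ verify U b (e, k, leftEnd e t, rightEnd e t (colour e (w e) (val x) t), x),
        s ∈ S) →
      ∀ b, ∀ s ∈ verify U b (e, k, leftEnd e t, rightEnd e t (colour e (w e) (val x) t), x),
        condC U s x ≤ eLen e + n + c := by
  obtain ⟨h, hh, hen⟩ := exists_enumeration (partrec_verify hU.1)
  -- `e` is determined by the length of `x`, and the numbers of the edge and of the pair are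
  -- separated by their lengths
  set ε : Str → ℕ := fun x => (x.length - 26) / 8
  have hε : Primrec ε := by fun_prop
  set D : (Str × Str) × ℕ → Datum × ℕ := fun a =>
    let e := ε a.1.2
    let t := val (a.1.1.take (eLen e))
    ((e, a.1.1.length + e, leftEnd e t, rightEnd e t (colour e a.2 (val a.1.2) t), a.1.2),
      val (a.1.1.drop (eLen e))) with hD
  have htake : Primrec fun a : (Str × Str) × ℕ => a.1.1.take (eLen (ε a.1.2)) :=
    Primrec.list_take.comp (by fun_prop) (by fun_prop)
  have hdrop : Primrec fun a : (Str × Str) × ℕ => a.1.1.drop (eLen (ε a.1.2)) :=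
    Primrec.list_drop.comp (by fun_prop) (by fun_prop)
  have hDp : Primrec D := by
    have h1 : Primrec fun a : (Str × Str) × ℕ => val (a.1.1.take (eLen (ε a.1.2))) :=
      primrec_val.comp htake
    have h2 : Primrec fun a : (Str × Str) × ℕ => val (a.1.1.drop (eLen (ε a.1.2))) :=
      primrec_val.comp hdrop
    simp only [hD]
    fun_prop
  have hDw : Computable fun a : Str × Str => D (a, w (ε a.2)) :=
    hDp.to_comp.comp (Computable.pair Computable.id (hw.comp (hε.to_comp.comp Computable.snd)))
  obtain ⟨τ, hτ⟩ := hU.2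
    (fun r x => h (D ((r, x), w (ε x))).1 (D ((r, x), w (ε x))).2)
    (Partrec₂.comp hh (Computable.fst.comp hDw) (Computable.snd.comp hDw))
  refine ⟨τ.length, fun e k n t x S hx ht hk hS hsub b s hs => ?_⟩
  obtain ⟨i, hi, his⟩ := hen _ S hsub b s hs
  obtain ⟨r₁, hr₁, rfl⟩ := exists_val_eq ht
  obtain ⟨r₂, hr₂, rfl⟩ := exists_val_eq (hi.trans_le hS)
  have hεx : ε x = e := by simp [ε, hx, xLen]
  have hmem : s ∈ U (τ ++ (r₁ ++ r₂)) x := by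
    rw [hτ]
    have hDeq : D ((r₁ ++ r₂, x), w (ε x)) =
        ((e, k, leftEnd e (val r₁), rightEnd e (val r₁) (colour e (w e) (val x) (val r₁)), x),
          val r₂) := by
      simp only [hD, hεx, ← hr₁, List.take_left', List.drop_left', List.length_append, hr₂]
      rw [← hk, ← hr₁]
    rw [hDeq]
    exact his
  have h := condC_le hmem
  simp only [List.length_append, hr₁, hr₂] at h
  omega

/-- If `w` codes a good family of graphs, then some edge of some graph of the family has, for every
`k`, few linked pairs of programs whose joint complexity is at most `k`. -/
theorem IsOptimal.exists_light_edge (hU : IsOptimal U) {e w : ℕ} (hw : GoodFamily e w) :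
    ∃ (x : Str) (t : ℕ), x.length = xLen e ∧ t < 2 ^ eLen e ∧ ∀ k, ∃ S : Finset Str,
      (∀ b, ∀ s ∈ verify U b
        (e, k, leftEnd e t, rightEnd e t (colour e w (val x) t), x), s ∈ S) ∧
      (S = ∅ ∨ ∃ n, eLen e + n + e = k ∧ #S ≤ 2 ^ n) := by
  classical
  -- the numbering of programs
  obtain ⟨LP, hLP, hmemP⟩ := hU.exists_finset_condC_lt [] (vLen e + e)
  obtain ⟨P, hP, hPinj⟩ := exists_listing LP
  -- the sets of pairs
  set Q : ℕ → ℕ → Prop := fun k u => u / numP e < #LP ∧ u % numP e < #LP ∧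
    plainC U (pair (P (u / numP e)) (P (u % numP e))) ≤ k with hQ
  have hnn : 0 < numP e * numP e := by unfold numP; positivity
  obtain ⟨H, hH, hHd⟩ := exists_digit_eq (b := 2)
    (fun n => if Q (n / (numP e * numP e)) (n % (numP e * numP e)) then 1 else 0)
    (fun n => by split_ifs <;> norm_num) (kMax e * (numP e * numP e))
  have hlevel : ∀ k < kMax e, ∀ u < numP e * numP e, InLevel e H k u ↔ Q k u := by
    intro k hk u hu
    have hlt : k * (numP e * numP e) + u < kMax e * (numP e * numP e) := by
      calc k * (numP e * numP e) + u < (k + 1) * (numP e * numP e) := by rw [add_mul]; omega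
        _ ≤ _ := Nat.mul_le_mul_right _ hk
    have hdiv : (k * (numP e * numP e) + u) / (numP e * numP e) = k := by
      rw [mul_comm k, Nat.mul_add_div hnn, Nat.div_eq_of_lt hu, add_zero]
    have hmod : (k * (numP e * numP e) + u) % (numP e * numP e) = u := by
      rw [mul_comm k, Nat.mul_add_mod, Nat.mod_eq_of_lt hu]
    rw [InLevel, hHd _ hlt, hdiv, hmod]
    split_ifs with h <;> simp [h]
  obtain ⟨ξ, hξ, hgood⟩ := hw H hH
  obtain ⟨x, hx, rfl⟩ := exists_val_eq hξ
  -- the links of the programs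
  have hlink : ∀ p : Str, ∃ g : ℕ → Str, ∀ y, condC U y (pair p x) < e → ∃ i < 2 ^ e, g i = y := by
    intro p
    obtain ⟨L, hL, hmem⟩ := hU.exists_finset_condC_lt (pair p x) e
    obtain ⟨g, hg, -⟩ := exists_listing L
    refine ⟨g, fun y hy => ?_⟩
    obtain ⟨i, hi, h⟩ := hg y ((hmem y).2 hy)
    exact ⟨i, hi.trans hL, h⟩
  choose g hg using hlink
  obtain ⟨f, hf, hfd⟩ := exists_digit_eq (b := 2 ^ vLen e)
    (fun n => val (g (P (n / 2 ^ e)) (n % 2 ^ e)) % 2 ^ vLen e)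
    (fun n => Nat.mod_lt _ (Nat.two_pow_pos _)) (numP e * 2 ^ e)
  have hlinked : ∀ a < numP e, ∀ y : Str, y.length = vLen e → condC U y (pair (P a) x) < e →
      Linked e f a (val y) := by
    intro a ha y hy hc
    obtain ⟨i, hi, h⟩ := hg _ y hc
    refine ⟨i, hi, ?_⟩
    have hlt : a * 2 ^ e + i < numP e * 2 ^ e := by
      calc a * 2 ^ e + i < (a + 1) * 2 ^ e := by rw [add_mul]; omega
        _ ≤ _ := Nat.mul_le_mul_right _ ha
    have hdiv : (a * 2 ^ e + i) / 2 ^ e = a := by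
      rw [mul_comm, Nat.mul_add_div (Nat.two_pow_pos _), Nat.div_eq_of_lt hi, add_zero]
    have hmod : (a * 2 ^ e + i) % 2 ^ e = i := by
      rw [mul_comm, Nat.mul_add_mod, Nat.mod_eq_of_lt hi]
    rw [hfd _ hlt, hdiv, hmod, h, Nat.mod_eq_of_lt (hy ▸ val_lt y)]
  obtain ⟨t, ht, hlight⟩ : ∃ t < 2 ^ eLen e,
      ¬ Heavy e H f (leftEnd e t) (rightEnd e t (colour e w (val x) t)) := by
    by_contra! hcon
    have h := hgood f hf
    rw [Nat.count_iff_forall.2 fun {t} ht => hcon t ht] at h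
    have := Nat.two_pow_pos (eLen e)
    omega
  refine ⟨x, t, hx, ht, fun k => ?_⟩
  set y := leftEnd e t
  set z := rightEnd e t (colour e w (val x) t)
  set W : Finset ℕ := {u ∈ range (numP e * numP e) | Q k u ∧ Linked e f (u / numP e) y ∧
    Linked e f (u % numP e) z}
  have hsub : ∀ b, ∀ s ∈ verify U b (e, k, y, z, x),
      s ∈ W.image fun u => pair (P (u / numP e)) (P (u % numP e)) := by
    intro b s hs
    obtain ⟨p, q, y', z', rfl, hk, hp, hq, hy, hz, hyl, hzl, hyv, hzv⟩ :=
      hU.exists_mem_verify_iff.1 ⟨b, hs⟩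
    obtain ⟨i, hi, rfl⟩ := hP p ((hmemP p).2 hp)
    obtain ⟨j, hj, rfl⟩ := hP q ((hmemP q).2 hq)
    have hi' : i < numP e := hi.trans hLP
    have hj' : j < numP e := hj.trans hLP
    have hdiv : (numP e * i + j) / numP e = i := by
      rw [Nat.mul_add_div (by omega), Nat.div_eq_of_lt hj', add_zero]
    have hmod : (numP e * i + j) % numP e = j := by
      rw [Nat.mul_add_mod, Nat.mod_eq_of_lt hj']
    refine mem_image.2 ⟨numP e * i + j, mem_filter.2 ⟨mem_range.2 ?_, ?_⟩, by rw [hdiv, hmod]⟩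
    · calc numP e * i + j < numP e * (i + 1) := by rw [mul_add]; omega
        _ ≤ _ := Nat.mul_le_mul_left _ hi'
    · simp only [hQ, hdiv, hmod]
      exact ⟨⟨hi, hj, hk⟩, hyv ▸ hlinked i hi' y' hyl hy, hzv ▸ hlinked j hj' z' hzl hz⟩
  refine ⟨_, hsub, ?_⟩
  rcases lt_or_ge k (kMax e) with hk | hk
  · have hcount : linkCount e H f k y z = #W := by
      rw [linkCount, Nat.count_eq_card_filter_range]
      refine congrArg card (filter_congr fun u hu => ?_)
      rw [PairLinked, hlevel k hk u (mem_range.1 hu)]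
    have hcard : levelCard e H k ≤ 2 ^ (k + 1) := by
      obtain ⟨L, hL, hmem⟩ := hU.exists_finset_condC_lt [] (k + 1)
      refine le_trans ?_ hL.le
      rw [levelCard, Nat.count_eq_card_filter_range]
      refine card_le_card_of_injOn (fun u => pair (P (u / numP e)) (P (u % numP e))) ?_ ?_
      · intro u hu
        obtain ⟨hu, hl⟩ := mem_filter.1 hu
        exact (hmem _).2 (Nat.lt_succ_of_le ((hlevel k hk u (mem_range.1 hu)).1 hl).2.2)
      · intro u hu u' hu' heq
        obtain ⟨hu, hl⟩ := mem_filter.1 hu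
        obtain ⟨hu', hl'⟩ := mem_filter.1 hu'
        have hq := (hlevel k hk u (mem_range.1 hu)).1 hl
        have hq' := (hlevel k hk u' (mem_range.1 hu')).1 hl'
        obtain ⟨h1, h2⟩ := pair_injective heq
        rw [← Nat.div_add_mod u (numP e), ← Nat.div_add_mod u' (numP e),
          (hPinj _ hq.1).2 _ hq'.1 h1, (hPinj _ hq.2.1).2 _ hq'.2.1 h2]
    rcases W.eq_empty_or_nonempty with hW0 | hW0
    · exact .inl (by rw [hW0, image_empty])
    · right
      have hlt : #W * 2 ^ (eLen e + e) < 2 ^ k := by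
        by_contra! hge
        exact hlight ⟨k, hk, hcard, hcount ▸ hW0.card_pos, hcount ▸ hge⟩
      have hle : eLen e + e < k := by
        refine (Nat.pow_lt_pow_iff_right one_lt_two).1 (lt_of_le_of_lt ?_ hlt)
        exact Nat.le_mul_of_pos_left _ hW0.card_pos
      obtain ⟨n, rfl⟩ := Nat.exists_eq_add_of_lt hle
      refine ⟨n + 1, by ring, card_image_le.trans ?_⟩
      refine Nat.le_of_mul_le_mul_right (hlt.le.trans_eq ?_) (Nat.two_pow_pos (eLen e + e))
      ring
  · -- there are too few pairs of programs for the level to matter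
    right
    refine ⟨k - (eLen e + e), by unfold kMax at hk; omega, card_image_le.trans ?_⟩
    calc #W ≤ numP e * numP e := (card_filter_le _ _).trans (by simp)
      _ = 2 ^ (2 * (vLen e + e)) := by unfold numP; ring
      _ ≤ _ := Nat.pow_le_pow_right two_pos (by unfold kMax at hk; omega)

end Main

end Kolmogorov


theorem theorem3 (U : Kolmogorov.Str → Kolmogorov.Str →. Kolmogorov.Str)
    (hU : Kolmogorov.IsOptimal U) :
    ∃ c : ℕ, ∀ ε : ℕ, ∃ x y z : Kolmogorov.Str,
      x.length < 9 * ε + c ∧ y.length < 9 * ε + c ∧ z.length < 9 * ε + c ∧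
      ∀ p q : Kolmogorov.Str,
        Kolmogorov.condC U y (Kolmogorov.pair p x) < ε →
        Kolmogorov.condC U z (Kolmogorov.pair q x) < ε →
        (Kolmogorov.plainC U p : ℤ) < (Kolmogorov.condC U y x : ℤ) + (ε : ℤ) - (c : ℤ) →
        (Kolmogorov.plainC U q : ℤ) < (Kolmogorov.condC U z x : ℤ) + (ε : ℤ) - (c : ℤ) →
        (Kolmogorov.plainC U (Kolmogorov.pair p q) : ℤ) -
            (Kolmogorov.condC U (Kolmogorov.pair p q) x : ℤ) ≥ (ε : ℤ) - (c : ℤ) := by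
  obtain ⟨w, hw, hgood⟩ := Kolmogorov.exists_computable_family
  obtain ⟨c₁, hc₁⟩ := hU.exists_const_condC_le_length
  obtain ⟨c₂, hc₂⟩ := hU.exists_const_condC_pair_le hw
  refine ⟨c₁ + c₂ + 27, fun ε => ?_⟩
  obtain ⟨x, t, hx, ht, hlight⟩ := hU.exists_light_edge (hgood ε)
  obtain ⟨y, hy, hyv⟩ := Kolmogorov.exists_val_eq (Kolmogorov.leftEnd_lt ht)
  obtain ⟨z, hz, hzv⟩ := Kolmogorov.exists_val_eq (Kolmogorov.rightEnd_lt (t := t)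
    (show Kolmogorov.colour ε (w ε) (Kolmogorov.val x) t < Kolmogorov.numD ε from
      Nat.mod_lt _ (Kolmogorov.numD_pos ε)))
  refine ⟨x, y, z, by rw [hx, Kolmogorov.xLen]; omega, by rw [hy, Kolmogorov.vLen]; omega,
    by rw [hz, Kolmogorov.vLen]; omega, fun p q hyp hzq hp hq => ?_⟩
  have hyx := hc₁ y x
  have hzx := hc₁ z x
  obtain ⟨b, hb⟩ := hU.exists_mem_verify_iff.2 ⟨p, q, y, z, rfl, le_rfl, by omega, by omega, hyp,
    hzq, hy, hz, hyv, hzv⟩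
  obtain ⟨S, hS, rfl | ⟨n, hn, hcard⟩⟩ := hlight (Kolmogorov.plainC U (Kolmogorov.pair p q))
  · exact absurd (hS b _ hb) (Finset.notMem_empty _)
  · have h := hc₂ ε _ n t x S hx ht hn hcard hS b _ hb
    omega
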